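/- Let $V$ be a finite set of users with $|V|\ge 2$, let $\mathsf Z_V=(\mathsf Z_i:i\in V)$ be a vector of discrete random variables with finite joint entropy, and for $X\subseteq V$ let $H(X)$ be the Shannon entropy of $(\mathsf Z_i:i\in X)$ in some fixed base $b>1$, with $H(X|Y)=H(X\cup Y)-H(Y)$. For $r\in\mathbb R^V$ put $r(X)=\sum_{i\in X}r_i$, and let $$\mathcal R(V)=\{r\in\mathbb R^V: r(X)\ge H(X|V\setminus X)\ \text{for all } X\subsetneq V\},$$ $$R_{ACO}(V)=\min\{r(V): r\in\mathcal R(V)\},\qquad \mathcal R^*_{ACO}(V)=\{r\in\mathcal R(V): r(V)=R_{ACO}(V)\},$$ $$R_{NCO}(V)=\min\{r(V): r\in\mathcal R(V)\cap\mathbb Z^V\},\qquad \mathcal R^*_{NCO}(V)=\{r\in\mathcal R(V)\cap\mathbb Z^V: r(V)=R_{NCO}(V)\}.$$ For $\alpha\in\mathbb R$ let $f_\alpha(X)=H(X|V\setminus X)$ for $X\subsetneq V$, $f_\alpha(V)=\alpha$, and $f^\#_\alpha(X)=\alpha-f_\alpha(V\setminus X)$. For a family $U$ of subsets of $V$ write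 $\tilde U=\bigcup_{X\in U}X$. Let $\Phi=(\phi_1,\dots,\phi_{|V|})$ be a linear ordering of $V$. Algorithm CoordSatCapFus$(V,H,\alpha,\Phi)$: set $r_i=\alpha-H(V)$ for all $i\in V$, then $r_{\phi_1}=f^\#_\alpha(\{\phi_1\})$ and $\mathcal P^*=\{\{\phi_1\}\}$. For $i=2,\dots,|V|$: let $\hat\xi$ be the minimum of $f^\#_\alpha(\{\phi_i\}\cup\tilde U)-r(\{\phi_i\}\cup\tilde U)$ over $U\subseteq\mathcal P^*$ and $U^*$ the smallest (with respect to inclusion) minimizer; increase $r_{\phi_i}$ by $\hat\xi$; with $T=\tilde U^*\cup\{\phi_i\}$ and $\mathcal X=\{X\in\mathcal P^*:X\cap T\ne\emptyset\}$ replace $\mathcal P^*$ by $(\mathcal P^*\setminus\mathcal X)\cup\{T\cup\tilde{\mathcal X}\}$. Return $(r,\mathcal P^*)$. Algorithm MDA$(V,H,\Phi)$: for a partition $\mathcal P$ of $V$ put $\alpha(\mathcal P)=\sum_{X\in\mathcal P}\frac{H(V)-H(X)}{|\mathcal P|-1}$. Start with the partition $\mathcal P$ of $V$ into singletons, $\alpha=\alpha(\mathcal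 P)$ and $(r,\mathcal P^*)=$ CoordSatCapFus$(V,H,\alpha,\Phi)$. While $\mathcal P^*\ne\mathcal P$: set $\mathcal P=\mathcal P^*$, $\alpha=\alpha(\mathcal P^*)$ and $(r,\mathcal P^*)=$ CoordSatCapFus$(V,H,\alpha,\Phi)$. Return $r$, $\mathcal P^*$, $\alpha$. Let $w\in\mathbb R^V$ be nonnegative and let $\Phi$ be consistent with $w$, that is, $w_{\phi_1}\le w_{\phi_2}\le\dots\le w_{\phi_{|V|}}$. Then: (1) The minimum $R_{ACO}(V)$ is attained, MDA$(V,H,\Phi)$ terminates, and the rate vector $r$ it returns lies in $\mathcal R^*_{ACO}(V)$ and minimizes $\sum_{i\in V}w_ir_i$ over $\mathcal R^*_{ACO}(V)$. (2) Suppose, in addition, that $H(X)$ is a nonnegative integer for every $X\subseteq V$ (the non-asymptotic model). Then the minimum $R_{NCO}(V)$ is attained, and CoordSatCapFus$(V,H,\lceil R_{ACO}(V)\rceil,\Phi)$ returns a rate vector $r$ that is integral, lies in $\mathcal R^*_{NCO}(V)$ and minimizes $\sum_{i\in V}w_ir_i$ over $\mathcal R^*_{NCO}(V)$. -/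

import Mathlib

/-- Shannon entropy `H(Z_X)`, in logarithm base `b`, of the subvector `Z_X = (Z_i : i ∈ X)` of a
vector of discrete random variables `Z_V` with joint distribution `p`.  (A `PMF` on any type has
countable support, so the alphabets `A i` may be arbitrary.) -/
noncomputable def CO.entropy {V : Type*} {A : V → Type*} (b : ℝ) (p : PMF (∀ i, A i))
    (X : Finset V) : ℝ :=
  (∑' a : (∀ i : X, A i), Real.negMulLog ((p.map X.restrict) a).toReal) / Real.log b

/-- The joint distribution has finite entropy (automatic for finite alphabets). -/
def CO.FiniteEntropy {V : Type*} {A : V → Type*} (p : PMF (∀ i, A i)) : Prop :=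
  Summable fun z => Real.negMulLog (p z).toReal

namespace CO

section

variable {V : Type*} [Fintype V] [DecidableEq V]

/-- `H(X | Y) = H(X ∪ Y) - H(Y)`. -/
def condEntropy (H : Finset V → ℝ) (X Y : Finset V) : ℝ := H (X ∪ Y) - H Y

/-- `r(X) = ∑_{i ∈ X} r_i`. -/
def rateSum (r : V → ℝ) (X : Finset V) : ℝ := ∑ i ∈ X, r i

/-- The set of achievable rate vectors: the Slepian-Wolf constraints for all proper subsets. -/
def achievable (H : Finset V → ℝ) : Set (V → ℝ) :=
  {r | ∀ X : Finset V, X ⊂ Finset.univ → condEntropy H X (Finset.univ \ X) ≤ rateSum r X}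

/-- Vectors with integer coordinates. -/
def integral : Set (V → ℝ) := {r | ∀ i, ∃ m : ℤ, r i = m}

/-- The minimum sum-rate in the asymptotic model. -/
noncomputable def minSumRate (H : Finset V → ℝ) : ℝ :=
  sInf ((fun r => rateSum r Finset.univ) '' achievable H)

/-- The optimal rates in the asymptotic model. -/
def optimalRates (H : Finset V → ℝ) : Set (V → ℝ) :=
  {r ∈ achievable H | rateSum r Finset.univ = minSumRate H}

/-- The minimum sum-rate in the non-asymptotic model. -/
noncomputable def minIntSumRate (H : Finset V → ℝ) : ℝ :=
  sInf ((fun r => rateSum r Finset.univ) '' (achievable H ∩ integral))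

/-- The optimal rates in the non-asymptotic model. -/
def optimalIntRates (H : Finset V → ℝ) : Set (V → ℝ) :=
  {r ∈ achievable H ∩ integral | rateSum r Finset.univ = minIntSumRate H}

/-- The set function `f_α`. -/
def fAlpha (H : Finset V → ℝ) (α : ℝ) (X : Finset V) : ℝ :=
  if X = Finset.univ then α else condEntropy H X (Finset.univ \ X)

/-- The dual set function `f_α^#`. -/
def fDual (H : Finset V → ℝ) (α : ℝ) (X : Finset V) : ℝ :=
  fAlpha H α Finset.univ - fAlpha H α (Finset.univ \ X)

/-- The fusion `Ũ = ⋃_{X ∈ U} X`. -/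
def fusion (U : Finset (Finset V)) : Finset V := U.sup id

/-- The objective `f_α^#({φ} ∪ Ũ) - r({φ} ∪ Ũ)` of the saturation capacity problem. -/
def satObjective (H : Finset V → ℝ) (α : ℝ) (r : V → ℝ) (φ : V) (U : Finset (Finset V)) : ℝ :=
  fDual H α ({φ} ∪ fusion U) - rateSum r ({φ} ∪ fusion U)

/-- The minimizers of the saturation capacity problem over `U ⊆ P`. -/
def satMinimizers (H : Finset V → ℝ) (α : ℝ) (r : V → ℝ) (P : Finset (Finset V)) (φ : V) :
    Set (Finset (Finset V)) :=
  {U | U ⊆ P ∧ ∀ W, W ⊆ P → satObjective H α r φ U ≤ satObjective H α r φ W}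

/-- `U_φ^* = U^* ∪ {{φ}}`. -/
def augment (φ : V) (U : Finset (Finset V)) : Finset (Finset V) := U ∪ {{φ}}

/-- The blocks of `P` that meet the set `T`. -/
def meeting (P : Finset (Finset V)) (T : Finset V) : Finset (Finset V) :=
  P.filter fun X => (X ∩ T).Nonempty

/-- `(P \ 𝒳) ∪ {T ∪ 𝒳~}`, where `𝒳` is the set of the blocks of `P` that meet `T`. -/
def merge (P : Finset (Finset V)) (T : Finset V) : Finset (Finset V) :=
  (P \ meeting P T) ∪ {T ∪ fusion (meeting P T)}

/-- `CoordSatCapFus.Reaches H α Φ i r P`: after the user `Φ i` (users are numbered from `0`) has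
been processed, the variables of the algorithm CoordSatCapFus with input `H`, `α`, `Φ` are the
rate vector `r` and the partition `P` of the users processed so far. -/
inductive CoordSatCapFus.Reaches (H : Finset V → ℝ) (α : ℝ) (Φ : Fin (Fintype.card V) ≃ V) :
    ℕ → (V → ℝ) → Finset (Finset V) → Prop
  | init (h : 0 < Fintype.card V) :
      CoordSatCapFus.Reaches H α Φ 0
        (Function.update (fun _ => α - H Finset.univ) (Φ ⟨0, h⟩) (fDual H α {Φ ⟨0, h⟩}))
        {{Φ ⟨0, h⟩}}
  | step (i : ℕ) (h : i + 1 < Fintype.card V) (r : V → ℝ) (P U : Finset (Finset V)) :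
      CoordSatCapFus.Reaches H α Φ i r P →
      IsLeast (satMinimizers H α r P (Φ ⟨i + 1, h⟩)) U →
      CoordSatCapFus.Reaches H α Φ (i + 1)
        (r + Pi.single (Φ ⟨i + 1, h⟩) (satObjective H α r (Φ ⟨i + 1, h⟩) U))
        (merge P (fusion (augment (Φ ⟨i + 1, h⟩) U)))

/-- CoordSatCapFus with input `H`, `α`, `Φ` returns `r` and `P`. -/
def CoordSatCapFus.Returns (H : Finset V → ℝ) (α : ℝ) (Φ : Fin (Fintype.card V) ≃ V)
    (r : V → ℝ) (P : Finset (Finset V)) : Prop :=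
  ∃ i : ℕ, i + 1 = Fintype.card V ∧ CoordSatCapFus.Reaches H α Φ i r P

/-- The partition of `V` into singletons. -/
def singletons : Finset (Finset V) := Finset.univ.image fun i => {i}

/-- `∑_{X ∈ P} (H(V) - H(X)) / (|P| - 1)`. -/
noncomputable def estimate (H : Finset V → ℝ) (P : Finset (Finset V)) : ℝ :=
  ∑ X ∈ P, (H Finset.univ - H X) / ((P.card : ℝ) - 1)

/-- `MDA.Reaches H Φ P α r Q`: the algorithm MDA with input `H`, `Φ` gets to a test of the
condition of its while loop with the values `P` of the previous partition, `α` of the estimate,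
and `(r, Q)` of the latest pair returned by CoordSatCapFus. -/
inductive MDA.Reaches (H : Finset V → ℝ) (Φ : Fin (Fintype.card V) ≃ V) :
    Finset (Finset V) → ℝ → (V → ℝ) → Finset (Finset V) → Prop
  | init (r : V → ℝ) (Q : Finset (Finset V)) :
      CoordSatCapFus.Returns H (estimate H singletons) Φ r Q →
      MDA.Reaches H Φ singletons (estimate H singletons) r Q
  | step (P : Finset (Finset V)) (α : ℝ) (r r' : V → ℝ) (Q Q' : Finset (Finset V)) :
      MDA.Reaches H Φ P α r Q →
      Q ≠ P →
      CoordSatCapFus.Returns H (estimate H Q) Φ r' Q' →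
      MDA.Reaches H Φ Q (estimate H Q) r' Q'

/-- MDA with input `H`, `Φ` terminates and returns the rate vector `r`, the partition `Q` and the
estimate `α`. -/
def MDA.Returns (H : Finset V → ℝ) (Φ : Fin (Fintype.card V) ≃ V)
    (r : V → ℝ) (Q : Finset (Finset V)) (α : ℝ) : Prop :=
  ∃ P, MDA.Reaches H Φ P α r Q ∧ Q = P

/-- `r` minimizes the weighted sum-rate `∑ i, w_i r_i` over the set `S`. -/
def IsWeightedMin (w : V → ℝ) (S : Set (V → ℝ)) (r : V → ℝ) : Prop :=
  r ∈ S ∧ ∀ r' ∈ S, ∑ i, w i * r i ≤ ∑ i, w i * r' i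

end

end CO

/-! Entropy is submodular, so g(X) = H(X) + α - H(V) is submodular on intersecting pairs. By
complementation, a vector of total α is achievable exactly when r ≤ g on nonempty sets
(`mem_achievable_iff`). CoordSatCapFus is the greedy algorithm for this polyhedron: it raises each
coordinate until some set is tight, and uncrossing keeps the processed users partitioned into tight
blocks. A partition bounds the prefix sum of any feasible vector by the sum of g over its blocks,
and the greedy vector attains that bound. So greedy maximizes all prefix sums, and for ascending
weights Abel summation gives weighted optimality among feasible vectors of the same total.

It remains to find α. Summing the constraints over a partition P with at least two blocks gives r(V)
≥ α(P) for every achievable r. MDA is a discrete Newton iteration on this bound: greedy at α(P)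
yields Q with α(Q) ≥ α(P), and equality forces r(V) = α(P), the optimum. Choosing the least
minimizer at each step keeps Q from collapsing to the single block V
(`CoordSatCapFus.Reaches.refines`). Termination follows because there are finitely many partitions.

With integer entropies, greedy at the ceiling of the minimum sum-rate stays integral and attains
that total, which no integral achievable vector can undercut. -/

namespace CO

set_option linter.unusedSectionVars false

open scoped ENNReal

/-! ### Submodularity of Shannon entropy -/

section Entropy

variable {Ω β γ δ : Type*}

/-- The self-information `-log x` of a probability `x`. -/
noncomputable def selfInfo (x : ℝ≥0∞) : ℝ≥0∞ := ENNReal.ofReal (-Real.log x.toReal)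

theorem negMulLog_toReal {x : ℝ≥0∞} (hx : x ≤ 1) :
    Real.negMulLog x.toReal = (x * selfInfo x).toReal := by
  have h1 : x.toReal ≤ 1 := by simpa using ENNReal.toReal_mono ENNReal.one_ne_top hx
  have h2 : Real.log x.toReal ≤ 0 := Real.log_nonpos ENNReal.toReal_nonneg h1
  rw [ENNReal.toReal_mul, selfInfo, ENNReal.toReal_ofReal (by linarith), Real.negMulLog]
  ring

theorem mul_selfInfo_ne_top {x : ℝ≥0∞} (hx : x ≤ 1) : x * selfInfo x ≠ ∞ :=
  ENNReal.mul_ne_top (ne_top_of_le_ne_top ENNReal.one_ne_top hx) ENNReal.ofReal_ne_top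

theorem tsum_map_mul (q : PMF Ω) (f : Ω → β) (G : β → ℝ≥0∞) :
    ∑' b, q.map f b * G b = ∑' a, q a * G (f a) := by
  simp_rw [PMF.map_apply, ← ENNReal.tsum_mul_right]
  rw [ENNReal.tsum_comm]
  refine tsum_congr fun a => ?_
  rw [tsum_eq_single (f a)]
  · simp
  · intro b hb
    simp [hb]

theorem apply_le_map_apply (q : PMF Ω) (f : Ω → β) (a : Ω) : q a ≤ q.map f (f a) := by
  rw [PMF.map_apply]
  refine le_trans ?_ (ENNReal.le_tsum a)
  simp

theorem map_apply_ne_zero {q : PMF Ω} (f : Ω → β) {a : Ω} (ha : q a ≠ 0) : q.map f (f a) ≠ 0 :=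
  fun h => ha (le_zero_iff.1 (h ▸ apply_le_map_apply q f a))

/-- Entropy of `f` under `q`, in nats. -/
noncomputable def natEntropy (q : PMF Ω) (f : Ω → β) : ℝ≥0∞ :=
  ∑' a, q a * selfInfo (q.map f (f a))

/-- Moving the sum from the alphabet of `f` to the sample space lets entropies of different
functions be compared pointwise; in `ℝ≥0∞` no summability is needed. -/
theorem tsum_negMulLog_map (q : PMF Ω) (f : Ω → β) :
    ∑' b, Real.negMulLog (q.map f b).toReal = (natEntropy q f).toReal := by
  rw [natEntropy, ← tsum_map_mul q f (fun b => selfInfo (q.map f b)),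
    ENNReal.tsum_toReal_eq fun b => mul_selfInfo_ne_top (PMF.coe_le_one _ b)]
  exact tsum_congr fun b => negMulLog_toReal (PMF.coe_le_one _ b)

theorem selfInfo_anti {x y : ℝ≥0∞} (hx : x ≠ 0) (hxy : x ≤ y) (hy : y ≤ 1) :
    selfInfo y ≤ selfInfo x := by
  have hy' : y ≠ ∞ := ne_top_of_le_ne_top ENNReal.one_ne_top hy
  refine ENNReal.ofReal_le_ofReal (neg_le_neg (Real.log_le_log ?_ (ENNReal.toReal_mono hy' hxy)))
  exact ENNReal.toReal_pos hx (ne_top_of_le_ne_top hy' hxy)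

/-- A point mass only grows under `f`, so self-information only drops, and the joint entropy
dominates. -/
theorem natEntropy_ne_top (q : PMF Ω) (f : Ω → β)
    (hq : Summable fun z => Real.negMulLog (q z).toReal) : natEntropy q f ≠ ∞ := by
  have h : ∑' a, q a * selfInfo (q a) ≠ ∞ := by
    have : (fun a => q a * selfInfo (q a))
        = fun a => ENNReal.ofReal (Real.negMulLog (q a).toReal) := by
      funext a
      rw [negMulLog_toReal (PMF.coe_le_one _ a),
        ENNReal.ofReal_toReal (mul_selfInfo_ne_top (PMF.coe_le_one _ a))]
    rw [this]
    exact hq.tsum_ofReal_ne_top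
  refine ne_top_of_le_ne_top h (ENNReal.tsum_le_tsum fun a => ?_)
  by_cases ha : q a = 0
  · simp [ha]
  · exact mul_le_mul_right (selfInfo_anti ha (apply_le_map_apply q f a) (PMF.coe_le_one _ _)) _

/-- This is log u ≤ u - 1 at u = zt/(xy), arranged without subtraction. -/
theorem selfInfo_add_selfInfo_le {x y z t : ℝ≥0∞} (hx : x ≤ 1) (hy : y ≤ 1) (hz : z ≤ 1)
    (ht : t ≤ 1) (hx0 : x ≠ 0) (hy0 : y ≠ 0) (hz0 : z ≠ 0) (ht0 : t ≠ 0) :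
    selfInfo x + selfInfo y + 1 ≤ selfInfo z + selfInfo t + z * t / (x * y) := by
  have key : ∀ u : ℝ≥0∞, u ≤ 1 → u ≠ 0 → u ≠ ∞ ∧ 0 < u.toReal ∧ 0 ≤ -Real.log u.toReal := by
    intro u hu hu0
    have hu' : u ≠ ∞ := ne_top_of_le_ne_top ENNReal.one_ne_top hu
    refine ⟨hu', ENNReal.toReal_pos hu0 hu', ?_⟩
    have : u.toReal ≤ 1 := by simpa using ENNReal.toReal_mono ENNReal.one_ne_top hu
    linarith [Real.log_nonpos ENNReal.toReal_nonneg this]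
  obtain ⟨x1, x2, x3⟩ := key x hx hx0
  obtain ⟨y1, y2, y3⟩ := key y hy hy0
  obtain ⟨z1, z2, z3⟩ := key z hz hz0
  obtain ⟨t1, t2, t3⟩ := key t ht ht0
  have hR : z * t / (x * y) = ENNReal.ofReal (z.toReal * t.toReal / (x.toReal * y.toReal)) := by
    rw [ENNReal.ofReal_div_of_pos (by positivity), ENNReal.ofReal_mul z2.le,
      ENNReal.ofReal_mul x2.le, ENNReal.ofReal_toReal x1, ENNReal.ofReal_toReal y1,
      ENNReal.ofReal_toReal z1, ENNReal.ofReal_toReal t1]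
  have hlog := Real.log_le_sub_one_of_pos
    (show 0 < z.toReal * t.toReal / (x.toReal * y.toReal) by positivity)
  rw [Real.log_div (by positivity) (by positivity), Real.log_mul z2.ne' t2.ne',
    Real.log_mul x2.ne' y2.ne'] at hlog
  rw [hR, selfInfo, selfInfo, selfInfo, selfInfo, ← ENNReal.ofReal_one,
    ← ENNReal.ofReal_add x3 y3, ← ENNReal.ofReal_add (add_nonneg x3 y3) zero_le_one,
    ← ENNReal.ofReal_add z3 t3, ← ENNReal.ofReal_add (add_nonneg z3 t3) (by positivity)]
  exact ENNReal.ofReal_le_ofReal (by linarith)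

/-- The total mass of the coupling of `f` and `g` that makes them independent given `h`. -/
theorem tsum_condIndep_le_one (q : PMF Ω) (f : Ω → β) (g : Ω → γ) (k : β → δ) (l : γ → δ)
    (hkl : ∀ a, k (f a) = l (g a)) :
    ∑' a, q a * (q.map f (f a) * q.map g (g a) /
      (q.map (fun a => (f a, g a)) (f a, g a) * q.map (fun a => k (f a)) (k (f a)))) ≤ 1 := by
  classical
  have hl : (fun a => k (f a)) = fun a => l (g a) := funext hkl
  set J := q.map fun a => (f a, g a) with hJ
  set h := q.map fun a => k (f a) with hh
  calc ∑' a, q a * (q.map f (f a) * q.map g (g a) / (J (f a, g a) * h (k (f a))))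
      = ∑' c : β × γ, J c * (q.map f c.1 * q.map g c.2 / (J c * h (k c.1))) :=
        (tsum_map_mul q (fun a => (f a, g a))
          fun c => q.map f c.1 * q.map g c.2 / (J c * h (k c.1))).symm
    _ ≤ ∑' c : β × γ, q.map f c.1 * (q.map g c.2 * if k c.1 = l c.2 then (h (k c.1))⁻¹ else 0) := by
        refine ENNReal.tsum_le_tsum fun c => ?_
        by_cases hc : J c = 0
        · simp [hc]
        have hc' : J c ≠ ∞ := PMF.apply_ne_top _ _
        have hkc : k c.1 = l c.2 := by
          have := (PMF.mem_support_iff _ c).2 hc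
          rw [hJ, PMF.mem_support_map_iff] at this
          obtain ⟨a, -, rfl⟩ := this
          exact hkl a
        rw [if_pos hkc, ENNReal.div_eq_inv_mul, ENNReal.mul_inv (Or.inl hc) (Or.inl hc'),
          ← mul_assoc, ← mul_assoc (J c), ENNReal.mul_inv_cancel hc hc', one_mul, mul_comm, mul_assoc]
    _ = ∑' b : β, q.map f b * ∑' c : γ, q.map g c * if k b = l c then (h (k b))⁻¹ else 0 := by
        rw [ENNReal.tsum_prod (f := fun b c =>
          q.map f b * (q.map g c * if k b = l c then (h (k b))⁻¹ else 0))]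
        simp_rw [ENNReal.tsum_mul_left]
    -- For fixed `b`, the values `c` with `l c = k b` have total mass `h (k b)`, which cancels its
    -- inverse, or gives 0 if it vanishes.
    _ ≤ ∑' b : β, q.map f b := by
        refine ENNReal.tsum_le_tsum fun b => mul_le_of_le_one_right' ?_
        rw [tsum_map_mul q g fun c => if k b = l c then (h (k b))⁻¹ else 0]
        have : h (k b) = ∑' a, if k b = l (g a) then q a else 0 := by
          rw [hh, hl, PMF.map_apply]
        have h2 : ∑' a, (q a * if k b = l (g a) then (h (k b))⁻¹ else 0)
            = h (k b) * (h (k b))⁻¹ := by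
          conv_rhs => rw [this, ← ENNReal.tsum_mul_right, ← this]
          refine tsum_congr fun a => ?_
          split_ifs <;> simp
        rw [h2]
        exact ENNReal.mul_inv_le_one _
    _ = 1 := PMF.tsum_coe _

/-- Averaging the pointwise inequality leaves a ratio term, the mass of the conditionally
independent coupling. It is at most 1, so it is absorbed by the 1 added to both sides. -/
theorem natEntropy_submodular (q : PMF Ω) (f : Ω → β) (g : Ω → γ) (k : β → δ) (l : γ → δ)
    (hkl : ∀ a, k (f a) = l (g a)) :
    natEntropy q (fun a => (f a, g a)) + natEntropy q (fun a => k (f a)) ≤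
      natEntropy q f + natEntropy q g := by
  have h1 : natEntropy q (fun a => (f a, g a)) + natEntropy q (fun a => k (f a)) + 1 ≤
      natEntropy q f + natEntropy q g + 1 := by
    refine le_trans ?_ (add_le_add_right (tsum_condIndep_le_one q f g k l hkl) _)
    rw [natEntropy, natEntropy, natEntropy, natEntropy, ← q.tsum_coe, ← ENNReal.tsum_add,
      ← ENNReal.tsum_add, ← ENNReal.tsum_add, ← ENNReal.tsum_add]
    refine ENNReal.tsum_le_tsum fun a => ?_
    by_cases ha : q a = 0
    · simp [ha]
    have key := selfInfo_add_selfInfo_le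
      (PMF.coe_le_one (q.map fun a => (f a, g a)) (f a, g a))
      (PMF.coe_le_one (q.map fun a => k (f a)) (k (f a)))
      (PMF.coe_le_one (q.map f) (f a)) (PMF.coe_le_one (q.map g) (g a))
      (map_apply_ne_zero (fun a => (f a, g a)) ha) (map_apply_ne_zero (fun a => k (f a)) ha)
      (map_apply_ne_zero f ha) (map_apply_ne_zero g ha)
    have := mul_le_mul_right key (q a)
    simpa only [mul_add, mul_one] using this
  exact (ENNReal.add_le_add_iff_right ENNReal.one_ne_top).1 h1

theorem natEntropy_congr (q : PMF Ω) (f : Ω → β) (g : Ω → γ)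
    (hfg : ∀ a a', f a = f a' ↔ g a = g a') : natEntropy q f = natEntropy q g := by
  classical
  refine tsum_congr fun a => ?_
  have : q.map f (f a) = q.map g (g a) := by
    rw [PMF.map_apply, PMF.map_apply]
    refine tsum_congr fun a' => ?_
    simp only [hfg]
  rw [this]

end Entropy

theorem entropy_submodular {V : Type*} [DecidableEq V] {A : V → Type*} {b : ℝ} (hb : 1 < b)
    (p : PMF (∀ i, A i)) (hp : FiniteEntropy p) (X Y : Finset V) :
    entropy b p (X ∪ Y) + entropy b p (X ∩ Y) ≤ entropy b p X + entropy b p Y := by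
  have hlog : 0 < Real.log b := Real.log_pos hb
  simp only [entropy, tsum_negMulLog_map, ← add_div]
  refine div_le_div_of_nonneg_right ?_ hlog.le
  rw [← ENNReal.toReal_add (natEntropy_ne_top _ _ hp) (natEntropy_ne_top _ _ hp),
    ← ENNReal.toReal_add (natEntropy_ne_top _ _ hp) (natEntropy_ne_top _ _ hp)]
  refine ENNReal.toReal_mono (ENNReal.add_ne_top.2
    ⟨natEntropy_ne_top _ _ hp, natEntropy_ne_top _ _ hp⟩) ?_
  have key := natEntropy_submodular p X.restrict Y.restrict
    (Finset.restrict₂ (π := A) (Finset.inter_subset_left (s₁ := X) (s₂ := Y)))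
    (Finset.restrict₂ (π := A) (Finset.inter_subset_right (s₁ := X) (s₂ := Y))) (fun a => rfl)
  refine le_trans (le_of_eq ?_) key
  congr 1
  refine natEntropy_congr _ _ _ fun a a' => ?_
  simp only [Prod.mk.injEq, funext_iff, Finset.restrict, Subtype.forall, Finset.mem_union]
  exact ⟨fun h => ⟨fun i hi => h i (Or.inl hi), fun i hi => h i (Or.inr hi)⟩,
    fun h i hi => hi.elim (h.1 i) (h.2 i)⟩

/-! ### Intersecting submodularity, partitions and one greedy step -/

section Combinatorics

variable {V : Type*} [Fintype V] [DecidableEq V]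

theorem mem_fusion {U : Finset (Finset V)} {x : V} : x ∈ fusion U ↔ ∃ B ∈ U, x ∈ B := by
  simp [fusion, Finset.mem_sup]

/-- Submodularity on intersecting pairs of sets. -/
def IntersectingSubmodular (g : Finset V → ℝ) : Prop :=
  ∀ X Y : Finset V, (X ∩ Y).Nonempty → g (X ∪ Y) + g (X ∩ Y) ≤ g X + g Y

/-- The empty set is exceptional: there `fDual` is 0 by definition. Hence submodularity is claimed
only for intersecting pairs. -/
theorem fDual_of_nonempty (H : Finset V → ℝ) (α : ℝ) {X : Finset V} (hX : X.Nonempty) :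
    fDual H α X = H X + α - H Finset.univ := by
  have h : Finset.univ \ X ≠ Finset.univ := by
    obtain ⟨x, hx⟩ := hX
    intro h
    have := h ▸ Finset.mem_univ x
    simp [hx] at this
  simp only [fDual, fAlpha, if_true, if_neg h, condEntropy]
  rw [Finset.sdiff_sdiff_eq_self (Finset.subset_univ X),
    Finset.sdiff_union_of_subset (Finset.subset_univ X)]
  ring

theorem fDual_intersectingSubmodular {H : Finset V → ℝ} (hH : IntersectingSubmodular H) (α : ℝ) :
    IntersectingSubmodular (fDual H α) := by
  intro X Y hXY
  rw [fDual_of_nonempty H α hXY, fDual_of_nonempty H α (hXY.mono Finset.inter_subset_left),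
    fDual_of_nonempty H α (hXY.mono Finset.inter_subset_right),
    fDual_of_nonempty H α (hXY.mono
      (Finset.inter_subset_left.trans Finset.subset_union_left))]
  linarith [hH X Y hXY]

theorem rateSum_union_inter (r : V → ℝ) (X Y : Finset V) :
    rateSum r (X ∪ Y) + rateSum r (X ∩ Y) = rateSum r X + rateSum r Y :=
  Finset.sum_union_inter

theorem rateSum_add_single_of_mem (r : V → ℝ) (x : ℝ) {φ : V} {X : Finset V} (h : φ ∈ X) :
    rateSum (r + Pi.single φ x) X = rateSum r X + x := by
  simp [rateSum, Finset.sum_add_distrib, h]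

theorem rateSum_add_single_of_notMem (r : V → ℝ) (x : ℝ) {φ : V} {X : Finset V} (h : φ ∉ X) :
    rateSum (r + Pi.single φ x) X = rateSum r X := by
  simp [rateSum, Finset.sum_add_distrib, h]

/-- `P` is a partition of `S` into nonempty blocks. -/
structure IsPartition (S : Finset V) (P : Finset (Finset V)) : Prop where
  fusion_eq : fusion P = S
  nonempty : ∀ X ∈ P, X.Nonempty
  eq_of_mem : ∀ X ∈ P, ∀ Y ∈ P, ∀ x, x ∈ X → x ∈ Y → X = Y

theorem IsPartition.subset {S : Finset V} {P : Finset (Finset V)} (hP : IsPartition S P)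
    {X : Finset V} (hX : X ∈ P) : X ⊆ S := fun _ hx =>
  hP.fusion_eq ▸ mem_fusion.2 ⟨X, hX, hx⟩

theorem IsPartition.exists_mem {S : Finset V} {P : Finset (Finset V)} (hP : IsPartition S P)
    {x : V} (hx : x ∈ S) : ∃ B ∈ P, x ∈ B := by
  rw [← hP.fusion_eq] at hx
  exact mem_fusion.1 hx

theorem IsPartition.rateSum_eq {S : Finset V} {P : Finset (Finset V)} (hP : IsPartition S P)
    (r : V → ℝ) : rateSum r S = ∑ X ∈ P, rateSum r X := by
  have h : fusion P = P.biUnion id := Finset.sup_eq_biUnion _ _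
  rw [← hP.fusion_eq, h, rateSum, Finset.sum_biUnion]
  · rfl
  · intro X hX Y hY hne
    refine Finset.disjoint_left.2 fun x hx hy => hne ?_
    exact hP.eq_of_mem X hX Y hY x hx hy

theorem IsPartition.notMem_block {S : Finset V} {P : Finset (Finset V)} (hP : IsPartition S P)
    {φ : V} (hφ : φ ∉ S) {X : Finset V} (hX : X ∈ P) : φ ∉ X := fun h => hφ (hP.subset hX h)

theorem fusion_augment (φ : V) (U : Finset (Finset V)) :
    fusion (augment φ U) = {φ} ∪ fusion U := by
  ext x
  simp only [augment, mem_fusion, Finset.mem_union, Finset.mem_singleton]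
  grind

/-- Blocks are disjoint and avoid the new user, so the merge step fuses exactly the blocks in `U`
with `φ`. -/
theorem IsPartition.meeting_eq {S : Finset V} {P : Finset (Finset V)} (hP : IsPartition S P)
    {φ : V} (hφ : φ ∉ S) {U : Finset (Finset V)} (hU : U ⊆ P) :
    meeting P ({φ} ∪ fusion U) = U := by
  ext B
  simp only [meeting, Finset.mem_filter]
  constructor
  · rintro ⟨hB, x, hx⟩
    rw [Finset.mem_inter, Finset.mem_union, Finset.mem_singleton, mem_fusion] at hx
    rcases hx with ⟨hxB, rfl | ⟨C, hC, hxC⟩⟩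
    · exact absurd hxB (hP.notMem_block hφ hB)
    · rwa [hP.eq_of_mem B hB C (hU hC) x hxB hxC]
  · intro hB
    obtain ⟨x, hx⟩ := hP.nonempty B (hU hB)
    exact ⟨hU hB, x, Finset.mem_inter.2 ⟨hx, Finset.mem_union_right _ (mem_fusion.2 ⟨B, hB, hx⟩)⟩⟩

theorem IsPartition.mem_merge {S : Finset V} {P : Finset (Finset V)} (hP : IsPartition S P)
    {φ : V} (hφ : φ ∉ S) {U : Finset (Finset V)} (hU : U ⊆ P) {B : Finset V} :
    B ∈ merge P (fusion (augment φ U)) ↔ (B ∈ P ∧ B ∉ U) ∨ B = {φ} ∪ fusion U := by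
  rw [merge, fusion_augment, hP.meeting_eq hφ hU, Finset.union_assoc, Finset.union_self,
    Finset.mem_union, Finset.mem_sdiff, Finset.mem_singleton]

theorem IsPartition.merge {S : Finset V} {P : Finset (Finset V)} (hP : IsPartition S P)
    {φ : V} (hφ : φ ∉ S) {U : Finset (Finset V)} (hU : U ⊆ P) :
    IsPartition (insert φ S) (merge P (fusion (augment φ U))) where
  fusion_eq := by
    ext x
    rw [mem_fusion, Finset.mem_insert]
    constructor
    · rintro ⟨B, hB, hx⟩
      rcases (hP.mem_merge hφ hU).1 hB with ⟨hB, -⟩ | rfl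
      · exact Or.inr (hP.subset hB hx)
      · rcases Finset.mem_union.1 hx with hx | hx
        · exact Or.inl (Finset.mem_singleton.1 hx)
        · obtain ⟨C, hC, hx⟩ := mem_fusion.1 hx
          exact Or.inr (hP.subset (hU hC) hx)
    · rintro (rfl | hx)
      · exact ⟨_, (hP.mem_merge hφ hU).2 (Or.inr rfl), by simp⟩
      · obtain ⟨B, hB, hx⟩ := hP.exists_mem hx
        by_cases hBU : B ∈ U
        · exact ⟨_, (hP.mem_merge hφ hU).2 (Or.inr rfl),
            Finset.mem_union_right _ (mem_fusion.2 ⟨B, hBU, hx⟩)⟩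
        · exact ⟨B, (hP.mem_merge hφ hU).2 (Or.inl ⟨hB, hBU⟩), hx⟩
  nonempty := by
    intro X hX
    rcases (hP.mem_merge hφ hU).1 hX with ⟨hX, -⟩ | rfl
    · exact hP.nonempty X hX
    · exact ⟨φ, by simp⟩
  eq_of_mem := by
    have key : ∀ X ∈ P, X ∉ U → ∀ x ∈ X, x ∉ {φ} ∪ fusion U := by
      intro X hX hXU x hx h
      have := hP.meeting_eq hφ hU
      exact hXU (this ▸ Finset.mem_filter.2 ⟨hX, x, Finset.mem_inter.2 ⟨hx, h⟩⟩)
    intro X hX Y hY x hx hy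
    rcases (hP.mem_merge hφ hU).1 hX with ⟨hX, hXU⟩ | rfl <;>
      rcases (hP.mem_merge hφ hU).1 hY with ⟨hY, hYU⟩ | rfl
    · exact hP.eq_of_mem X hX Y hY x hx hy
    · exact absurd hy (key X hX hXU x hx)
    · exact absurd hx (key Y hY hYU x hy)
    · rfl

/-- `r`, restricted to `S`, lies in the polyhedron of `g`, and `P` is a partition of `S` into
tight sets. -/
structure IsGreedyState (g : Finset V → ℝ) (S : Finset V) (r : V → ℝ) (P : Finset (Finset V)) :
    Prop where
  partition : IsPartition S P
  le : ∀ X ⊆ S, X.Nonempty → rateSum r X ≤ g X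
  tight : ∀ X ∈ P, rateSum r X = g X

variable {H : Finset V → ℝ} {α : ℝ} {S : Finset V} {r : V → ℝ} {P : Finset (Finset V)} {φ : V}

/-- Absorbing a tight block that meets the set cannot increase the slack g - r: by submodularity the
slacks of union and intersection add up to at most the old slack, and the intersection has
nonnegative slack. -/
theorem union_fusion_le (hH : IntersectingSubmodular H) (hs : IsGreedyState (fDual H α) S r P)
    {X : Finset V} (W : Finset (Finset V)) (hW : W ⊆ meeting P X) :
    fDual H α (X ∪ fusion W) - rateSum r (X ∪ fusion W) ≤ fDual H α X - rateSum r X := by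
  induction W using Finset.induction_on with
  | empty => simp [fusion]
  | insert B W _ ih =>
    have hB := hW (Finset.mem_insert_self B W)
    obtain ⟨hBP, hBX⟩ := Finset.mem_filter.1 hB
    have ih := ih fun C hC => hW (Finset.mem_insert_of_mem hC)
    have hne : ((X ∪ fusion W) ∩ B).Nonempty := by
      obtain ⟨x, hx⟩ := hBX
      rw [Finset.mem_inter] at hx
      exact ⟨x, Finset.mem_inter.2 ⟨Finset.mem_union_left _ hx.2, hx.1⟩⟩
    have heq : X ∪ fusion (insert B W) = (X ∪ fusion W) ∪ B := by
      ext x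
      simp only [Finset.mem_union, mem_fusion, Finset.mem_insert]
      grind
    have h1 := fDual_intersectingSubmodular hH α _ _ hne
    have h2 := rateSum_union_inter r (X ∪ fusion W) B
    have h3 := hs.le _ (Finset.inter_subset_right.trans (hs.partition.subset hBP)) hne
    have h4 := hs.tight B hBP
    rw [heq]
    linarith

/-- Enlarging `X` by all blocks it meets shows that minimizing over unions of blocks is as good as
minimizing over all sets containing `φ`. -/
theorem exists_satObjective_le (hH : IntersectingSubmodular H)
    (hs : IsGreedyState (fDual H α) S r P) {X : Finset V} (hX : X ⊆ insert φ S) (hφX : φ ∈ X) :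
    ∃ W ⊆ P, satObjective H α r φ W ≤ fDual H α X - rateSum r X := by
  refine ⟨meeting P X, Finset.filter_subset _ _, ?_⟩
  have heq : {φ} ∪ fusion (meeting P X) = X ∪ fusion (meeting P X) := by
    ext x
    simp only [Finset.mem_union, Finset.mem_singleton]
    refine ⟨?_, ?_⟩
    · rintro (rfl | h)
      · exact Or.inl hφX
      · exact Or.inr h
    · rintro (h | h)
      · rcases Finset.mem_insert.1 (hX h) with rfl | hS
        · exact Or.inl rfl
        · obtain ⟨B, hB, hx⟩ := hs.partition.exists_mem hS
          exact Or.inr (mem_fusion.2 ⟨B, Finset.mem_filter.2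
            ⟨hB, x, Finset.mem_inter.2 ⟨hx, h⟩⟩, hx⟩)
      · exact Or.inr h
  rw [satObjective, heq]
  exact union_fusion_le hH hs _ subset_rfl

/-- The increment is the least slack of a set containing `φ`, so feasibility survives and the merged
block becomes tight. The earlier value of `r` at `φ` is immaterial, since the objective subtracts
it. -/
theorem IsGreedyState.step (hH : IntersectingSubmodular H) (hs : IsGreedyState (fDual H α) S r P)
    (hφ : φ ∉ S) {U : Finset (Finset V)} (hU : U ∈ satMinimizers H α r P φ) :
    IsGreedyState (fDual H α) (insert φ S) (r + Pi.single φ (satObjective H α r φ U))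
      (merge P (fusion (augment φ U))) where
  partition := hs.partition.merge hφ hU.1
  le := by
    intro X hX hne
    by_cases hφX : φ ∈ X
    · obtain ⟨W, hW, hle⟩ := exists_satObjective_le hH hs hX hφX
      rw [rateSum_add_single_of_mem _ _ hφX]
      linarith [hU.2 W hW]
    · rw [rateSum_add_single_of_notMem _ _ hφX]
      exact hs.le X ((Finset.subset_insert_iff_of_notMem hφX).1 hX) hne
  tight := by
    intro X hX
    rcases (hs.partition.mem_merge hφ hU.1).1 hX with ⟨hX, -⟩ | rfl
    · rw [rateSum_add_single_of_notMem _ _ (hs.partition.notMem_block hφ hX)]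
      exact hs.tight X hX
    · rw [rateSum_add_single_of_mem _ _ (by simp), satObjective]
      ring

/-- Minimizers of a submodular function are closed under intersection; all the sets compared share
`φ`, so intersecting submodularity suffices. -/
theorem inter_mem_satMinimizers (hH : IntersectingSubmodular H) (hP : IsPartition S P)
    {U W : Finset (Finset V)} (hU : U ∈ satMinimizers H α r P φ)
    (hW : W ∈ satMinimizers H α r P φ) : U ∩ W ∈ satMinimizers H α r P φ := by
  have hunion : ({φ} ∪ fusion U) ∪ ({φ} ∪ fusion W) = {φ} ∪ fusion (U ∪ W) := by
    ext x
    simp only [Finset.mem_union, mem_fusion, Finset.mem_singleton]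
    grind
  have hinter : ({φ} ∪ fusion U) ∩ ({φ} ∪ fusion W) = {φ} ∪ fusion (U ∩ W) := by
    ext x
    simp only [Finset.mem_union, mem_fusion, Finset.mem_singleton, Finset.mem_inter]
    constructor
    · rintro ⟨h | ⟨B, hB, hx⟩, h' | ⟨C, hC, hx'⟩⟩
      · exact Or.inl h
      · exact Or.inl h
      · exact Or.inl h'
      · have := hP.eq_of_mem B (hU.1 hB) C (hW.1 hC) x hx hx'
        exact Or.inr ⟨B, ⟨hB, this ▸ hC⟩, hx⟩
    · rintro (h | ⟨B, ⟨hB, hB'⟩, hx⟩)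
      · exact ⟨Or.inl h, Or.inl h⟩
      · exact ⟨Or.inr ⟨B, hB, hx⟩, Or.inr ⟨B, hB', hx⟩⟩
  have h1 := fDual_intersectingSubmodular hH α ({φ} ∪ fusion U) ({φ} ∪ fusion W) ⟨φ, by simp⟩
  have h2 := rateSum_union_inter r ({φ} ∪ fusion U) ({φ} ∪ fusion W)
  rw [hunion, hinter] at h1 h2
  have h3 := hU.2 (U ∪ W) (Finset.union_subset hU.1 hW.1)
  refine ⟨Finset.inter_subset_left.trans hU.1, fun Z hZ => ?_⟩
  have h4 := hW.2 Z hZ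
  have h5 := hU.2 Z hZ
  have h6 := hW.2 U hU.1
  simp only [satObjective] at *
  linarith

theorem exists_isLeast_satMinimizers (hH : IntersectingSubmodular H) (hP : IsPartition S P) :
    ∃ U, IsLeast (satMinimizers H α r P φ) U := by
  classical
  have hne : ∃ U, U ∈ satMinimizers H α r P φ := by
    obtain ⟨U, hU, h⟩ := Finset.exists_min_image P.powerset (satObjective H α r φ)
      ⟨∅, Finset.empty_mem_powerset _⟩
    exact ⟨U, Finset.mem_powerset.1 hU, fun W hW => h W (Finset.mem_powerset.2 hW)⟩
  obtain ⟨U, hU, hmin⟩ := exists_minimalFor_of_wellFoundedLT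
    (fun U => U ∈ satMinimizers H α r P φ) Finset.card hne
  refine ⟨U, hU, fun W hW => ?_⟩
  have h1 := inter_mem_satMinimizers hH hP hU hW
  have h2 := hmin h1 (Finset.card_le_card Finset.inter_subset_left)
  exact Finset.inter_eq_left.1 (Finset.eq_of_subset_of_card_le Finset.inter_subset_left h2)

/-! ### The full greedy run: prefix sums, weights, refinement and integrality -/

variable {Φ : Fin (Fintype.card V) ≃ V} {i : ℕ}

/-- The users `Φ 0, …, Φ i`. -/
def initialUsers (Φ : Fin (Fintype.card V) ≃ V) (i : ℕ) : Finset V :=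
  Finset.univ.filter fun v => (Φ.symm v : ℕ) ≤ i

theorem initialUsers_zero (h : 0 < Fintype.card V) : initialUsers Φ 0 = {Φ ⟨0, h⟩} := by
  ext v
  simp [initialUsers, ← Equiv.symm_apply_eq, Fin.ext_iff]

theorem initialUsers_succ (h : i + 1 < Fintype.card V) :
    initialUsers Φ (i + 1) = insert (Φ ⟨i + 1, h⟩) (initialUsers Φ i) := by
  ext v
  simp only [initialUsers, Finset.mem_filter, Finset.mem_univ, true_and, Finset.mem_insert,
    ← Equiv.symm_apply_eq, Fin.ext_iff]
  omega

theorem notMem_initialUsers {j : ℕ} (h : i + 1 < Fintype.card V) (hj : j ≤ i) :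
    Φ ⟨i + 1, h⟩ ∉ initialUsers Φ j := by
  simp [initialUsers]
  omega

theorem initialUsers_last (h : i + 1 = Fintype.card V) : initialUsers Φ i = Finset.univ := by
  ext v
  have := (Φ.symm v).2
  simp only [initialUsers, Finset.mem_filter, Finset.mem_univ, true_and, iff_true]
  omega

theorem CoordSatCapFus.Reaches.isGreedyState (hH : IntersectingSubmodular H)
    (h : CoordSatCapFus.Reaches H α Φ i r P) :
    IsGreedyState (fDual H α) (initialUsers Φ i) r P := by
  induction h with
  | init h =>
    rw [initialUsers_zero h]
    refine ⟨⟨?_, ?_, ?_⟩, ?_, ?_⟩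
    · simp [fusion]
    · simp
    · simp
    · intro X hX hne
      rw [(Finset.Nonempty.subset_singleton_iff hne).1 hX]
      simp [rateSum]
    · simp [rateSum]
  | step i h r P U _ hU ih =>
    rw [initialUsers_succ h]
    exact ih.step hH (notMem_initialUsers h le_rfl) hU.1

theorem CoordSatCapFus.Reaches.unique {r' : V → ℝ} {P' : Finset (Finset V)}
    (h : CoordSatCapFus.Reaches H α Φ i r P) (h' : CoordSatCapFus.Reaches H α Φ i r' P') :
    r = r' ∧ P = P' := by
  induction h generalizing r' P' with
  | init h => cases h'; exact ⟨rfl, rfl⟩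
  | step i h r P U _ hU ih =>
    cases h' with
    | step _ _ r₁ P₁ U₁ hr hU₁ =>
      obtain ⟨rfl, rfl⟩ := ih hr
      rw [hU.unique hU₁]
      exact ⟨rfl, rfl⟩

theorem CoordSatCapFus.exists_reaches (hH : IntersectingSubmodular H) (α : ℝ)
    (Φ : Fin (Fintype.card V) ≃ V) (i : ℕ) (h : i < Fintype.card V) :
    ∃ r P, CoordSatCapFus.Reaches H α Φ i r P := by
  induction i with
  | zero => exact ⟨_, _, .init h⟩
  | succ i ih =>
    obtain ⟨r, P, hr⟩ := ih (by omega)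
    obtain ⟨U, hU⟩ := exists_isLeast_satMinimizers (α := α) (r := r) hH
      (φ := Φ ⟨i + 1, h⟩) (hr.isGreedyState hH).partition
    exact ⟨_, _, .step i h r P U hr hU⟩

theorem CoordSatCapFus.exists_returns (hH : IntersectingSubmodular H) (hV : 0 < Fintype.card V)
    (α : ℝ) (Φ : Fin (Fintype.card V) ≃ V) : ∃ r P, CoordSatCapFus.Returns H α Φ r P := by
  obtain ⟨r, P, h⟩ := exists_reaches hH α Φ (Fintype.card V - 1) (by omega)
  exact ⟨r, P, _, by omega, h⟩

theorem CoordSatCapFus.Returns.unique {r' : V → ℝ} {P' : Finset (Finset V)}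
    (h : CoordSatCapFus.Returns H α Φ r P) (h' : CoordSatCapFus.Returns H α Φ r' P') :
    r = r' ∧ P = P' := by
  obtain ⟨i, hi, h⟩ := h
  obtain ⟨j, hj, h'⟩ := h'
  obtain rfl : i = j := by omega
  exact h.unique h'

theorem CoordSatCapFus.Returns.isGreedyState (hH : IntersectingSubmodular H)
    (h : CoordSatCapFus.Returns H α Φ r P) :
    IsGreedyState (fDual H α) Finset.univ r P := by
  obtain ⟨i, hi, h⟩ := h
  exact initialUsers_last hi ▸ h.isGreedyState hH

theorem IsPartition.rateSum_le {g : Finset V → ℝ} {r' : V → ℝ} (hP : IsPartition S P)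
    (hr' : ∀ X : Finset V, X.Nonempty → rateSum r' X ≤ g X) : rateSum r' S ≤ ∑ X ∈ P, g X := by
  rw [hP.rateSum_eq]
  exact Finset.sum_le_sum fun X hX => hr' X (hP.nonempty X hX)

theorem IsGreedyState.rateSum_eq {g : Finset V → ℝ} (hs : IsGreedyState g S r P) :
    rateSum r S = ∑ X ∈ P, g X := by
  rw [hs.partition.rateSum_eq]
  exact Finset.sum_congr rfl hs.tight

/-- The partial sums of the output of the greedy algorithm dominate those of every vector in the
polyhedron. -/
theorem CoordSatCapFus.Reaches.rateSum_le (hH : IntersectingSubmodular H)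
    (h : CoordSatCapFus.Reaches H α Φ i r P) {r' : V → ℝ}
    (hr' : ∀ X : Finset V, X.Nonempty → rateSum r' X ≤ fDual H α X) (j : ℕ) (hj : j ≤ i) :
    rateSum r' (initialUsers Φ j) ≤ rateSum r (initialUsers Φ j) := by
  -- The current partition gives one bound for both vectors: `r'` is below it and `r` attains it.
  -- Later steps leave earlier prefix sums unchanged.
  have last : ∀ {i r P}, CoordSatCapFus.Reaches H α Φ i r P →
      rateSum r' (initialUsers Φ i) ≤ rateSum r (initialUsers Φ i) := by
    intro i r P h
    have hs := h.isGreedyState hH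
    rw [hs.rateSum_eq]
    exact hs.partition.rateSum_le hr'
  induction h with
  | init h =>
    obtain rfl : j = 0 := by omega
    exact last (.init h)
  | step i h r P U hr hU ih =>
    rcases Nat.le_succ_iff.1 hj with hj | rfl
    · rw [rateSum_add_single_of_notMem _ _ (notMem_initialUsers h hj)]
      exact ih hj
    · exact last (.step i h r P U hr hU)

/-- Abel summation: a nonnegative prefix sum allows its weight to be raised to the next one. When
the total of `d` is zero, the bound becomes 0. -/
theorem sum_mul_le_of_initialUsers (w d : V → ℝ) (hΦ : Monotone fun k => w (Φ k)) (i : ℕ)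
    (hi : i < Fintype.card V) (hd : ∀ j ≤ i, 0 ≤ rateSum d (initialUsers Φ j)) :
    ∑ v ∈ initialUsers Φ i, w v * d v ≤ w (Φ ⟨i, hi⟩) * rateSum d (initialUsers Φ i) := by
  induction i with
  | zero => simp [initialUsers_zero hi, rateSum]
  | succ i ih =>
    have hn := notMem_initialUsers (Φ := Φ) hi le_rfl
    have h1 := ih (by omega) fun j hj => hd j (by omega)
    have h2 : w (Φ ⟨i, by omega⟩) ≤ w (Φ ⟨i + 1, hi⟩) := hΦ (by simp)
    have h3 := mul_le_mul_of_nonneg_right h2 (hd i (by omega))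
    simp only [rateSum] at *
    rw [initialUsers_succ hi, Finset.sum_insert hn, Finset.sum_insert hn]
    linarith

theorem CoordSatCapFus.Returns.weighted_le (hH : IntersectingSubmodular H)
    (h : CoordSatCapFus.Returns H α Φ r P) {w : V → ℝ} (hΦ : Monotone fun k => w (Φ k))
    {r' : V → ℝ} (hr' : ∀ X : Finset V, X.Nonempty → rateSum r' X ≤ fDual H α X)
    (htot : rateSum r' Finset.univ = rateSum r Finset.univ) :
    ∑ v, w v * r v ≤ ∑ v, w v * r' v := by
  obtain ⟨i, hi, h⟩ := h
  have hsub : ∀ X, rateSum (r - r') X = rateSum r X - rateSum r' X := fun X => by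
    simp [rateSum]
  have key := sum_mul_le_of_initialUsers w (r - r') hΦ i (by omega) fun j hj => by
    rw [hsub]
    linarith [h.rateSum_le hH hr' j hj]
  rw [initialUsers_last hi, hsub, htot, sub_self, mul_zero] at key
  simp only [Pi.sub_apply, mul_sub, Finset.sum_sub_distrib] at key
  linarith

theorem rateSum_congr {r r' : V → ℝ} {X : Finset V} (h : ∀ v ∈ X, r v = r' v) :
    rateSum r X = rateSum r' X := Finset.sum_congr rfl h

/-- The partition maintained by CoordSatCapFus is finer than every partition of `V` into sets that
are tight for the final rate vector. -/
theorem CoordSatCapFus.Reaches.refines (hH : IntersectingSubmodular H)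
    (h : CoordSatCapFus.Reaches H α Φ i r P) {s : V → ℝ} {P' : Finset (Finset V)}
    (hs : ∀ X : Finset V, X.Nonempty → rateSum s X ≤ fDual H α X)
    (hP' : IsPartition Finset.univ P') (ht : ∀ X ∈ P', rateSum s X = fDual H α X)
    (hrs : ∀ v ∈ initialUsers Φ i, r v = s v) : ∀ B ∈ P, ∃ X ∈ P', B ⊆ X := by
  induction h with
  | init h =>
    intro B hB
    obtain ⟨X, hX, hx⟩ := hP'.exists_mem (Finset.mem_univ (Φ ⟨0, h⟩))
    exact ⟨X, hX, by rw [Finset.mem_singleton.1 hB]; simpa using hx⟩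
  | step i h r P U hr hU ih =>
    set φ := Φ ⟨i + 1, h⟩ with hφdef
    have hφ : φ ∉ initialUsers Φ i := notMem_initialUsers h le_rfl
    have hg := hr.isGreedyState hH
    have hg' := hg.step hH hφ hU.1
    rw [initialUsers_succ h] at hrs
    have ih := ih fun v hv => by
      have hne : v ≠ φ := fun e => hφ (e ▸ hv)
      simpa [hne] using hrs v (Finset.mem_insert_of_mem hv)
    intro B hB
    rcases (hg.partition.mem_merge hφ hU.1.1).1 hB with ⟨hB, -⟩ | rfl
    · exact ih B hB
    set T := {φ} ∪ fusion U with hT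
    obtain ⟨X, hX, hφX⟩ := hP'.exists_mem (Finset.mem_univ φ)
    refine ⟨X, hX, ?_⟩
    have hTS := hg'.partition.subset hB
    have hφT : φ ∈ T := by simp [hT]
    -- By induction each block of `U` lies in one member of `P'`, so no block straddles the boundary
    -- of `X`.
    have hinter : {φ} ∪ fusion (U.filter fun C => C ⊆ X) = X ∩ T := by
      ext x
      simp only [hT, Finset.mem_union, Finset.mem_inter, mem_fusion, Finset.mem_singleton,
        Finset.mem_filter]
      constructor
      · rintro (rfl | ⟨C, ⟨hC, hCX⟩, hx⟩)
        · exact ⟨hφX, Or.inl rfl⟩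
        · exact ⟨hCX hx, Or.inr ⟨C, hC, hx⟩⟩
      · rintro ⟨hxX, hx | ⟨C, hC, hx⟩⟩
        · exact Or.inl hx
        · obtain ⟨Y, hY, hCY⟩ := ih C (hU.1.1 hC)
          have hYX := hP'.eq_of_mem Y hY X hX x (hCY hx) hxX
          exact Or.inr ⟨C, ⟨hC, hYX ▸ hCY⟩, hx⟩
    have hφXT : φ ∈ X ∩ T := Finset.mem_inter.2 ⟨hφX, hφT⟩
    have h1 := fDual_intersectingSubmodular hH α X T ⟨φ, hφXT⟩
    have h2 := rateSum_union_inter s X T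
    have h3 := hs (X ∪ T) ⟨φ, Finset.mem_union_left _ hφX⟩
    have h4 := ht X hX
    have h5 := hg'.tight T hB
    rw [rateSum_congr fun v hv => hrs v (hTS hv)] at h5
    have h6 : rateSum r (X ∩ T) + satObjective H α r φ U = rateSum s (X ∩ T) := by
      rw [← rateSum_add_single_of_mem _ _ hφXT]
      exact rateSum_congr fun v hv => hrs v (hTS (Finset.mem_inter.1 hv).2)
    -- Uncrossing: `X` and `T` are tight for `s`, hence so is `X ∩ T`. The blocks of `U` inside `X`
    -- therefore already minimize, and leastness puts all of `U` among them.
    have hmin : U.filter (fun C => C ⊆ X) ∈ satMinimizers H α r P φ := by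
      refine ⟨(Finset.filter_subset _ _).trans hU.1.1, fun W hW => le_trans ?_ (hU.1.2 W hW)⟩
      have : satObjective H α r φ (U.filter fun C => C ⊆ X) =
          fDual H α (X ∩ T) - rateSum r (X ∩ T) := by rw [satObjective, hinter]
      linarith
    have hsub := hU.2 hmin
    intro x hx
    rcases Finset.mem_union.1 hx with hx | hx
    · rwa [Finset.mem_singleton.1 hx]
    · obtain ⟨C, hC, hx⟩ := mem_fusion.1 hx
      exact (Finset.mem_filter.1 (hsub hC)).2 hx

theorem exists_int_rateSum {r : V → ℝ} (hr : r ∈ integral) (X : Finset V) :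
    ∃ m : ℤ, rateSum r X = m := by
  choose m hm using hr
  exact ⟨∑ i ∈ X, m i, by simp [rateSum, hm]⟩

theorem exists_int_fDual (hH : ∀ X, ∃ m : ℤ, H X = m) (a : ℤ) {X : Finset V}
    (hX : X.Nonempty) : ∃ m : ℤ, fDual H a X = m := by
  obtain ⟨m, hm⟩ := hH X
  obtain ⟨n, hn⟩ := hH Finset.univ
  exact ⟨m + a - n, by rw [fDual_of_nonempty H _ hX, hm, hn]; push_cast; ring⟩

theorem CoordSatCapFus.Reaches.integral (hH : ∀ X, ∃ m : ℤ, H X = m) {a : ℤ}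
    (h : CoordSatCapFus.Reaches H a Φ i r P) : r ∈ integral := by
  induction h with
  | init h =>
    intro v
    by_cases hv : v = Φ ⟨0, h⟩
    · subst hv
      obtain ⟨m, hm⟩ := exists_int_fDual hH a (Finset.singleton_nonempty (Φ ⟨0, h⟩))
      exact ⟨m, by simp [hm]⟩
    · obtain ⟨n, hn⟩ := hH Finset.univ
      exact ⟨a - n, by simp [hv, hn]⟩
  | step i h r P U _ _ ih =>
    intro v
    obtain ⟨k, hk⟩ := ih v
    by_cases hv : v = Φ ⟨i + 1, h⟩
    · subst hv
      have hne : ({Φ ⟨i + 1, h⟩} ∪ fusion U).Nonempty := ⟨Φ ⟨i + 1, h⟩, by simp⟩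
      obtain ⟨m, hm⟩ := exists_int_fDual hH a hne
      obtain ⟨n, hn⟩ := exists_int_rateSum ih ({Φ ⟨i + 1, h⟩} ∪ fusion U)
      refine ⟨k + (m - n), ?_⟩
      rw [Pi.add_apply, Pi.single_eq_same, satObjective, hm, hn, hk]
      push_cast
      ring
    · exact ⟨k, by simp [hv, hk]⟩

end Combinatorics

/-! ### Minimum sum-rate: partition bounds, Newton iteration, rounding up -/

section

variable {V : Type*} [Fintype V] [DecidableEq V] {H : Finset V → ℝ} {α : ℝ} {r : V → ℝ}
  {P Q : Finset (Finset V)} {Φ : Fin (Fintype.card V) ≃ V}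

theorem fDual_univ [Nonempty V] (H : Finset V → ℝ) (α : ℝ) : fDual H α Finset.univ = α := by
  rw [fDual_of_nonempty H α Finset.univ_nonempty]
  ring

/-- Achievability of `r`, in terms of the dual set function for `α = r(V)`. -/
theorem mem_achievable_iff :
    r ∈ achievable H ↔
      ∀ X : Finset V, X.Nonempty → rateSum r X ≤ fDual H (rateSum r Finset.univ) X := by
  have hcompl : ∀ X : Finset V, rateSum r (Finset.univ \ X) + rateSum r X = rateSum r Finset.univ :=
    fun X => Finset.sum_sdiff (Finset.subset_univ X)
  have hcond : ∀ X : Finset V, condEntropy H (Finset.univ \ X) X = H Finset.univ - H X := fun X => by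
    rw [condEntropy, Finset.sdiff_union_of_subset (Finset.subset_univ X)]
  have hdd : ∀ X : Finset V, Finset.univ \ (Finset.univ \ X) = X := fun X =>
    Finset.sdiff_sdiff_eq_self (Finset.subset_univ X)
  constructor
  · intro h X hX
    have h1 := h (Finset.univ \ X) (Finset.sdiff_ssubset (Finset.subset_univ X) hX)
    rw [hdd, hcond] at h1
    rw [fDual_of_nonempty H _ hX]
    linarith [hcompl X]
  · intro h X hX
    have hne : (Finset.univ \ X).Nonempty := Finset.sdiff_nonempty.2 hX.2
    have h1 := h _ hne
    have h2 := hcond (Finset.univ \ X)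
    rw [hdd] at h2
    rw [fDual_of_nonempty H _ hne] at h1
    linarith [hcompl X]

/-- The block sum minus α is affine in α with slope |P| - 1 and root `estimate H P`; later
comparisons read off its sign. -/
theorem sum_fDual (H : Finset V → ℝ) (α : ℝ) (hne : ∀ X ∈ P, X.Nonempty) (hP : 1 < P.card) :
    ∑ X ∈ P, fDual H α X = α - ((P.card : ℝ) - 1) * (estimate H P - α) := by
  have hc : ((P.card : ℝ) - 1) ≠ 0 := by
    have : (1 : ℝ) < P.card := by exact_mod_cast hP
    linarith
  rw [Finset.sum_congr rfl fun X hX => fDual_of_nonempty H α (hne X hX), estimate,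
    ← Finset.sum_div, mul_sub, mul_div_cancel₀ _ hc]
  simp only [Finset.sum_sub_distrib, Finset.sum_add_distrib, Finset.sum_const, nsmul_eq_mul]
  ring

theorem estimate_le_rateSum (hP : IsPartition Finset.univ P) (hc : 1 < P.card)
    (hr : r ∈ achievable H) : estimate H P ≤ rateSum r Finset.univ := by
  have h := hP.rateSum_le (mem_achievable_iff.1 hr)
  rw [sum_fDual H _ hP.nonempty hc] at h
  have : (1 : ℝ) < P.card := by exact_mod_cast hc
  by_contra! hlt
  have := mul_pos (sub_pos.2 this) (sub_pos.2 hlt)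
  linarith

theorem singletons_isPartition : IsPartition Finset.univ (singletons : Finset (Finset V)) where
  fusion_eq := by
    ext x
    simp [mem_fusion, singletons]
  nonempty := by simp [singletons]
  eq_of_mem := by simp [singletons]

theorem card_singletons : (singletons : Finset (Finset V)).card = Fintype.card V :=
  Finset.card_image_of_injective _ Finset.singleton_injective

theorem IsPartition.one_lt_card [Nonempty V] (hP : IsPartition Finset.univ P)
    (h : Finset.univ ∉ P) : 1 < P.card := by
  obtain ⟨x⟩ := ‹Nonempty V›
  obtain ⟨B, hB, -⟩ := hP.exists_mem (Finset.mem_univ x)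
  by_contra! hc
  refine h ?_
  have hPB : P = {B} := Finset.eq_singleton_iff_unique_mem.2
    ⟨hB, fun C hC => Finset.card_le_one.1 hc C hC B hB⟩
  have := hP.fusion_eq
  rw [hPB] at this
  simp only [fusion, Finset.sup_singleton, id] at this
  exact this ▸ hB

theorem IsPartition.univ_notMem (hP : IsPartition Finset.univ P) (h : 1 < P.card) :
    Finset.univ ∉ P := by
  intro hu
  obtain ⟨C, hC, hne⟩ := Finset.exists_mem_ne h Finset.univ
  obtain ⟨x, hx⟩ := hP.nonempty C hC
  exact hne (hP.eq_of_mem C hC _ hu x hx (Finset.mem_univ x))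

/-- One round of the discrete Newton iteration for the minimum sum-rate. -/
theorem CoordSatCapFus.Returns.newton [Nonempty V] (hH : IntersectingSubmodular H)
    (hP : IsPartition Finset.univ P) (hc : 1 < P.card)
    (h : CoordSatCapFus.Returns H (estimate H P) Φ r Q) :
    1 < Q.card ∧ estimate H P ≤ estimate H Q ∧
      (estimate H Q = estimate H P → rateSum r Finset.univ = estimate H P) := by
  have hs := h.isGreedyState hH
  have hle : ∀ X : Finset V, X.Nonempty → rateSum r X ≤ fDual H (estimate H P) X :=
    fun X hX => hs.le X (Finset.subset_univ X) hX
  have hsum := sum_fDual H (estimate H P) hP.nonempty hc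
  rw [sub_self, mul_zero, sub_zero] at hsum
  -- If `V` were a block, `r` would have total `estimate H P`, forcing every block of `P` to be
  -- tight. Refinement would then put `V` inside a block of `P`.
  have hcard : 1 < Q.card := by
    refine hs.partition.one_lt_card fun hu => ?_
    have htot : rateSum r Finset.univ = estimate H P := by rw [hs.tight _ hu, fDual_univ]
    have ht : ∀ X ∈ P, rateSum r X = fDual H (estimate H P) X := by
      refine (Finset.sum_eq_sum_iff_of_le fun X hX => hle X (hP.nonempty X hX)).1 ?_
      rw [← hP.rateSum_eq, hsum, htot]
    obtain ⟨i, hi, h⟩ := h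
    obtain ⟨X, hX, hX'⟩ := h.refines hH hle hP ht (fun _ _ => rfl) _ hu
    exact hP.univ_notMem hc (Finset.univ_subset_iff.1 hX' ▸ hX)
  have htot := hs.rateSum_eq
  rw [sum_fDual H _ hs.partition.nonempty hcard] at htot
  have h1 := hP.rateSum_le hle
  rw [hsum] at h1
  have h2 : (0 : ℝ) < (Q.card : ℝ) - 1 := sub_pos.2 (by exact_mod_cast hcard)
  refine ⟨hcard, ?_, fun heq => ?_⟩
  · by_contra! hlt
    linarith [mul_pos h2 (sub_pos.2 hlt)]
  · rw [htot, heq]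
    ring

theorem MDA.Reaches.invariant (hV : 1 < Fintype.card V) (hH : IntersectingSubmodular H)
    (h : MDA.Reaches H Φ P α r Q) :
    IsPartition Finset.univ P ∧ 1 < P.card ∧ α = estimate H P ∧
      CoordSatCapFus.Returns H α Φ r Q := by
  have : Nonempty V := Fintype.card_pos_iff.1 (by omega)
  induction h with
  | init r Q h => exact ⟨singletons_isPartition, by rwa [card_singletons], rfl, h⟩
  | step P α r r' Q Q' _ _ h' ih =>
    obtain ⟨hP, hc, rfl, h⟩ := ih
    exact ⟨(h.isGreedyState hH).partition, (h.newton hH hP hc).1, rfl, h'⟩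

theorem MDA.exists_returns (hV : 1 < Fintype.card V) (hH : IntersectingSubmodular H)
    (Φ : Fin (Fintype.card V) ≃ V) : ∃ r Q α, MDA.Returns H Φ r Q α := by
  have : Nonempty V := Fintype.card_pos_iff.1 (by omega)
  obtain ⟨r₀, Q₀, h₀⟩ := CoordSatCapFus.exists_returns hH (by omega)
    (estimate H (singletons : Finset (Finset V))) Φ
  -- Take a reachable partition of maximal estimate. The next round cannot raise the estimate, so it
  -- reruns greedy with the same α and, by determinism, returns the same `Q`, which passes the loop
  -- test.
  obtain ⟨P, ⟨α, r, Q, h⟩, hmax⟩ := Set.exists_max_image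
    {P | ∃ α r Q, MDA.Reaches H Φ P α r Q} (estimate H) (Set.toFinite _)
    ⟨_, _, _, _, .init r₀ Q₀ h₀⟩
  by_cases hQP : Q = P
  · exact ⟨r, Q, α, P, h, hQP⟩
  obtain ⟨r', Q', h'⟩ := CoordSatCapFus.exists_returns hH (by omega) (estimate H Q) Φ
  have hreach := MDA.Reaches.step P α r r' Q Q' h hQP h'
  refine ⟨r', Q', _, Q, hreach, ?_⟩
  obtain ⟨hP, hc, rfl, hret⟩ := h.invariant hV hH
  have heq : estimate H Q = estimate H P :=
    le_antisymm (hmax Q ⟨_, _, _, hreach⟩) (hret.newton hH hP hc).2.1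
  rw [heq] at h'
  exact (h'.unique hret).2

theorem CoordSatCapFus.Returns.mem_achievable (hH : IntersectingSubmodular H)
    (h : CoordSatCapFus.Returns H α Φ r Q) (htot : rateSum r Finset.univ = α) :
    r ∈ achievable H :=
  mem_achievable_iff.2 fun X hX => htot ▸
    (h.isGreedyState hH).le X (Finset.subset_univ X) hX

theorem MDA.Returns.isLeast (hV : 1 < Fintype.card V) (hH : IntersectingSubmodular H)
    (h : MDA.Returns H Φ r Q α) :
    rateSum r Finset.univ = α ∧ r ∈ achievable H ∧ CoordSatCapFus.Returns H α Φ r Q ∧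
      IsLeast ((fun r => rateSum r Finset.univ) '' achievable H) α := by
  have : Nonempty V := Fintype.card_pos_iff.1 (by omega)
  obtain ⟨P, h, rfl⟩ := h
  obtain ⟨hP, hc, rfl, hret⟩ := h.invariant hV hH
  have htot := (hret.newton hH hP hc).2.2 rfl
  have hach := hret.mem_achievable hH htot
  refine ⟨htot, hach, hret, ⟨r, hach, htot⟩, ?_⟩
  rintro _ ⟨r', hr', rfl⟩
  exact estimate_le_rateSum hP hc hr'

theorem MDA.Returns.isWeightedMin (hV : 1 < Fintype.card V) (hH : IntersectingSubmodular H)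
    {w : V → ℝ} (hΦ : Monotone fun k => w (Φ k)) (h : MDA.Returns H Φ r Q α) :
    IsWeightedMin w (optimalRates H) r := by
  obtain ⟨htot, hach, hret, hleast⟩ := h.isLeast hV hH
  have hmin : minSumRate H = α := hleast.csInf_eq
  refine ⟨⟨hach, htot.trans hmin.symm⟩, ?_⟩
  rintro r' ⟨hr', htot'⟩
  rw [hmin] at htot'
  exact hret.weighted_le hH hΦ (htot' ▸ mem_achievable_iff.1 hr') (htot'.trans htot.symm)

/-- For `α` at least the minimum sum-rate, CoordSatCapFus returns a base. -/
theorem CoordSatCapFus.Returns.rateSum_univ [Nonempty V] (hH : IntersectingSubmodular H)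
    {s : V → ℝ} (hs : s ∈ achievable H) (hα : rateSum s Finset.univ ≤ α)
    (h : CoordSatCapFus.Returns H α Φ r Q) : rateSum r Finset.univ = α := by
  have hg := h.isGreedyState hH
  by_cases hu : Finset.univ ∈ Q
  · rw [hg.tight _ hu, fDual_univ]
  have hc := hg.partition.one_lt_card hu
  have h1 := hg.le _ subset_rfl Finset.univ_nonempty
  rw [fDual_univ] at h1
  refine le_antisymm h1 ?_
  -- The estimate of `Q` is at most the total of `s`, hence at most α, so the block sum of `Q` is at
  -- least α.
  have h2 := (estimate_le_rateSum hg.partition hc hs).trans hα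
  rw [hg.rateSum_eq, sum_fDual H α hg.partition.nonempty hc]
  have h3 : (0 : ℝ) < (Q.card : ℝ) - 1 := sub_pos.2 (by exact_mod_cast hc)
  linarith [mul_nonneg h3.le (sub_nonneg.2 h2)]

/-- An integral achievable vector has an integer total no smaller than the real minimum, hence no
smaller than its ceiling; greedy reaches the ceiling. -/
theorem CoordSatCapFus.Returns.ceil_spec (hV : 1 < Fintype.card V)
    (hH : IntersectingSubmodular H) (hint : ∀ X, ∃ m : ℤ, H X = m)
    (hleast : IsLeast ((fun r => rateSum r Finset.univ) '' achievable H) (minSumRate H))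
    (h : CoordSatCapFus.Returns H (⌈minSumRate H⌉ : ℝ) Φ r Q) :
    r ∈ integral ∧ r ∈ achievable H ∧ rateSum r Finset.univ = ⌈minSumRate H⌉ ∧
      IsLeast ((fun r => rateSum r Finset.univ) '' (achievable H ∩ integral))
        (⌈minSumRate H⌉ : ℝ) := by
  have : Nonempty V := Fintype.card_pos_iff.1 (by omega)
  obtain ⟨⟨s, hs, htot_s⟩, hlb⟩ := hleast
  have htot := h.rateSum_univ hH hs (htot_s.trans_le (Int.le_ceil _))
  have hach := h.mem_achievable hH htot
  have hr : r ∈ integral := by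
    obtain ⟨i, -, h⟩ := h
    exact h.integral hint
  refine ⟨hr, hach, htot, ⟨r, ⟨hach, hr⟩, htot⟩, ?_⟩
  rintro _ ⟨r', ⟨hr', hr'int⟩, rfl⟩
  obtain ⟨m, hm⟩ := exists_int_rateSum hr'int Finset.univ
  have := hlb ⟨r', hr', rfl⟩
  simp only [hm] at this ⊢
  exact_mod_cast Int.ceil_le.2 this

end

end CO

theorem theorem2 {V : Type*} [Fintype V] [DecidableEq V] (hV : 1 < Fintype.card V)
    {A : V → Type*} (b : ℝ) (hb : 1 < b) (p : PMF (∀ i, A i)) (hp : CO.FiniteEntropy p)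
    (w : V → ℝ) (hw : ∀ i, 0 ≤ w i)
    (Φ : Fin (Fintype.card V) ≃ V) (hΦ : Monotone fun k => w (Φ k)) :
    (IsLeast ((fun r => CO.rateSum r Finset.univ) '' CO.achievable (CO.entropy b p))
        (CO.minSumRate (CO.entropy b p)) ∧
      (∃ r Q α, CO.MDA.Returns (CO.entropy b p) Φ r Q α) ∧
      ∀ r Q α, CO.MDA.Returns (CO.entropy b p) Φ r Q α →
        CO.IsWeightedMin w (CO.optimalRates (CO.entropy b p)) r) ∧
    ((∀ X : Finset V, ∃ m : ℕ, CO.entropy b p X = m) →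
      IsLeast ((fun r => CO.rateSum r Finset.univ) ''
          (CO.achievable (CO.entropy b p) ∩ CO.integral))
        (CO.minIntSumRate (CO.entropy b p)) ∧
      (∃ r Q, CO.CoordSatCapFus.Returns (CO.entropy b p)
        (⌈CO.minSumRate (CO.entropy b p)⌉ : ℝ) Φ r Q) ∧
      ∀ r Q, CO.CoordSatCapFus.Returns (CO.entropy b p)
          (⌈CO.minSumRate (CO.entropy b p)⌉ : ℝ) Φ r Q →
        r ∈ CO.integral ∧ CO.IsWeightedMin w (CO.optimalIntRates (CO.entropy b p)) r) := by
  have hH : CO.IntersectingSubmodular (CO.entropy b p) := fun X Y _ =>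
    CO.entropy_submodular hb p hp X Y
  obtain ⟨r₀, Q₀, α₀, h₀⟩ := CO.MDA.exists_returns hV hH Φ
  have hleast : IsLeast ((fun r => CO.rateSum r Finset.univ) '' CO.achievable (CO.entropy b p))
      (CO.minSumRate (CO.entropy b p)) := by
    have h := (h₀.isLeast hV hH).2.2.2
    rwa [show CO.minSumRate (CO.entropy b p) = α₀ from h.csInf_eq]
  refine ⟨⟨hleast, ⟨r₀, Q₀, α₀, h₀⟩, fun r Q α h => h.isWeightedMin hV hH hΦ⟩, fun hint => ?_⟩
  have hint' : ∀ X, ∃ m : ℤ, CO.entropy b p X = m := fun X => by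
    obtain ⟨m, hm⟩ := hint X
    exact ⟨m, by simp [hm]⟩
  obtain ⟨r₁, Q₁, h₁⟩ := CO.CoordSatCapFus.exists_returns hH (by omega)
    (⌈CO.minSumRate (CO.entropy b p)⌉ : ℝ) Φ
  have hl := (h₁.ceil_spec hV hH hint' hleast).2.2.2
  have hmin : CO.minIntSumRate (CO.entropy b p) = ⌈CO.minSumRate (CO.entropy b p)⌉ := hl.csInf_eq
  refine ⟨hmin ▸ hl, ⟨r₁, Q₁, h₁⟩, fun r Q h => ?_⟩
  obtain ⟨hr, hach, htot, -⟩ := h.ceil_spec hV hH hint' hleast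
  refine ⟨hr, ⟨⟨hach, hr⟩, htot.trans hmin.symm⟩, ?_⟩
  rintro r' ⟨⟨hr', -⟩, htot'⟩
  rw [hmin] at htot'
  exact h.weighted_le hH hΦ (htot' ▸ CO.mem_achievable_iff.1 hr') (htot'.trans htot.symm)
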